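/- Let $V(\rho)=2\cos(4\arctan\rho)=\dfrac{2(1-6\rho^2+\rho^4)}{(1+\rho^2)^2}$. Let $\lambda\in\mathbb{C}$ with $\operatorname{Re}\lambda\ge\frac12$, and let $u\in C^\infty([0,1];\mathbb{C})$ be a function, not identically zero on $[0,1]$, that satisfies the generalized eigenvalue equation $$-(1-\rho^2)u''(\rho)-2\,\frac{1-\rho^2}{\rho}\,u'(\rho)+2\lambda\rho\,u'(\rho)+\frac{V(\rho)}{\rho^2}\,u(\rho)+\lambda(\lambda+1)\,u(\rho)=0\qquad\text{for all }\rho\in(0,1).$$ Then $\lambda=1$ and there exists a nonzero constant $c\in\mathbb{C}$ such that $u(\rho)=\dfrac{c\,\rho}{1+\rho^2}$ for all $\rho\in[0,1]$. -/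

import Mathlib

open scoped ContDiff

/-- The potential `V(ρ) = 2 cos(4 arctan ρ)`. -/
noncomputable def potentialV (ρ : ℝ) : ℝ := 2 * Real.cos (4 * Real.arctan ρ)

/-- The rational form of the potential. -/
theorem potentialV_eq (ρ : ℝ) :
    potentialV ρ = 2 * (1 - 6 * ρ ^ 2 + ρ ^ 4) / (1 + ρ ^ 2) ^ 2 := by
  have h : (1 + ρ ^ 2) ≠ 0 := by positivity
  have e : 4 * Real.arctan ρ = 2 * (2 * Real.arctan ρ) := by ring
  rw [potentialV, e, Real.cos_two_mul, Real.cos_two_mul, Real.cos_sq_arctan]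
  field_simp
  ring

/-- `u` satisfies the eigenvalue equation with spectral parameter `lam` at the point `ρ`:
`-(1-ρ²)u'' - 2((1-ρ²)/ρ)u' + 2λρu' + (V(ρ)/ρ²)u + λ(λ+1)u = 0`.
This is used only at points `ρ` in the open interval `(0,1)`. -/
def SatisfiesEigenvalueODEAt (lam : ℂ) (u : ℝ → ℂ) (ρ : ℝ) : Prop :=
  -(1 - (ρ : ℂ) ^ 2) * deriv (deriv u) ρ
    - 2 * ((1 - (ρ : ℂ) ^ 2) / (ρ : ℂ)) * deriv u ρ
    + 2 * lam * (ρ : ℂ) * deriv u ρ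
    + ((potentialV ρ : ℝ) : ℂ) / (ρ : ℂ) ^ 2 * u ρ
    + lam * (lam + 1) * u ρ = 0

/-- `u` restricted to `[0,1]` is a function in `C^∞[0,1]` (one-sided derivatives of all orders
at the endpoints) that solves the eigenvalue equation. The coefficients are singular at `ρ = 0`,
so the equation is required on the open interval `(0,1)`. The values of `u` outside `[0,1]`
play no role. -/
structure IsSmoothEigenSolution (lam : ℂ) (u : ℝ → ℂ) : Prop where
  smooth : ContDiffOn ℝ ∞ u (Set.Icc 0 1)
  ode : ∀ ρ ∈ Set.Ioo (0 : ℝ) 1, SatisfiesEigenvalueODEAt lam u ρ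

/-! The potential V changes sign on (0,1), and g = ρ/(1+ρ²) is a genuine solution at λ = 1, so a
direct energy argument fails. The first-order operator `darboux`, built from g'/g so that g lies in
its kernel at λ = 1, removes this mode: it maps solutions to solutions of the equation whose
potential is `partnerPotential`, positive and decreasing on [0,1] (`darboux_partner_equation`).

A solution U of that equation gives a wave (T-t)^(-λ) U(r/(T-t)). Its energy balance in ρ is
`hasDerivAt_energyFlux`: for Re λ ≥ 1/2 the flux is nonincreasing. It tends to 0 at the centre and
is nonnegative on the light cone ρ = 1, so it vanishes and U = 0 (`partner_eq_zero`). Regularity of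
u at both endpoints supplies these two boundary facts.

A reverse first-order operator turns the transform back into (λ-1)² u
(`lam_sub_one_sq_mul_eq_zero`). Hence λ = 1, and u lies in the kernel spanned by g. -/

open Set Filter Topology

/-! ### Energy flux for the partner equation -/

/-- The repulsive potential `2(3-ρ²)/(1+ρ²)` of the supersymmetric partner equation. -/
noncomputable def partnerPotential (ρ : ℝ) : ℝ := 2 * (3 - ρ ^ 2) / (1 + ρ ^ 2)

theorem partnerPotential_pos {ρ : ℝ} (h0 : 0 ≤ ρ) (h1 : ρ ≤ 1) : 0 < partnerPotential ρ := by
  unfold partnerPotential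
  have : 0 < 3 - ρ ^ 2 := by nlinarith
  positivity

theorem hasDerivAt_partnerPotential (ρ : ℝ) :
    HasDerivAt partnerPotential (-16 * ρ / (1 + ρ ^ 2) ^ 2) ρ := by
  have h : (1 + ρ ^ 2) ≠ 0 := by positivity
  have := (((hasDerivAt_pow 2 ρ).const_sub 3).const_mul 2).div
    ((hasDerivAt_pow 2 ρ).const_add 1) h
  refine this.congr_deriv ?_
  field_simp
  push_cast
  ring

/-- The flux function of the self-similar energy density, for `U` with derivative `P`. -/
noncomputable def energyFlux (lam : ℂ) (U P : ℝ → ℂ) (ρ : ℝ) : ℝ :=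
  ρ * (ρ ^ 2 * (Complex.normSq (lam * U ρ + ρ * P ρ) + Complex.normSq (P ρ))
    + partnerPotential ρ * Complex.normSq (U ρ)) / 2
  - ρ ^ 2 * ((lam * U ρ + ρ * P ρ).re * (P ρ).re + (lam * U ρ + ρ * P ρ).im * (P ρ).im)

/-- This is the energy identity with the time-derivative multiplier λU + ρP. The last term is ρ/2
times the derivative of the potential. -/
theorem hasDerivAt_energyFlux {lam : ℂ} {U P : ℝ → ℂ} {D : ℂ} {ρ : ℝ} (hρ : ρ ≠ 0)
    (hU : HasDerivAt U (P ρ) ρ) (hP : HasDerivAt P D ρ)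
    (hD : -(1 - (ρ : ℂ) ^ 2) * D - 2 * ((1 - (ρ : ℂ) ^ 2) / (ρ : ℂ)) * P ρ
      + 2 * lam * (ρ : ℂ) * P ρ + ((partnerPotential ρ : ℝ) : ℂ) / (ρ : ℂ) ^ 2 * U ρ
      + lam * (lam + 1) * U ρ = 0) :
    HasDerivAt (energyFlux lam U P)
      ((1 - 2 * lam.re) * (ρ ^ 2 * (Complex.normSq (lam * U ρ + ρ * P ρ) + Complex.normSq (P ρ))
        + partnerPotential ρ * Complex.normSq (U ρ)) / 2
        - 8 * ρ ^ 2 / (1 + ρ ^ 2) ^ 2 * Complex.normSq (U ρ)) ρ := by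
  have hid : HasDerivAt (fun x : ℝ => x) 1 ρ := hasDerivAt_id ρ
  have hidc : HasDerivAt (fun x : ℝ => (x : ℂ)) 1 ρ := hid.ofReal_comp
  have re {f : ℝ → ℂ} {f' : ℂ} (h : HasDerivAt f f' ρ) :
      HasDerivAt (fun x => (f x).re) f'.re ρ :=
    Complex.reCLM.hasFDerivAt.comp_hasDerivAt ρ h
  have im {f : ℝ → ℂ} {f' : ℂ} (h : HasDerivAt f f' ρ) :
      HasDerivAt (fun x => (f x).im) f'.im ρ :=
    Complex.imCLM.hasFDerivAt.comp_hasDerivAt ρ h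
  have nsq {f : ℝ → ℂ} {f' : ℂ} (h : HasDerivAt f f' ρ) :
      HasDerivAt (fun x => Complex.normSq (f x))
        (2 * ((f ρ).re * f'.re + (f ρ).im * f'.im)) ρ := by
    simp only [Complex.normSq_apply]
    exact (((re h).mul (re h)).add ((im h).mul (im h))).congr_deriv (by ring)
  have hN : HasDerivAt (fun x : ℝ => lam * U x + x * P x)
      (lam * P ρ + (1 * P ρ + ρ * D)) ρ := (hU.const_mul lam).add (hidc.mul hP)
  have hV := hasDerivAt_partnerPotential ρ
  have key := ((hid.mul (((hid.pow 2).mul ((nsq hN).add (nsq hP))).add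
    (hV.mul (nsq hU)))).div_const 2).sub
    ((hid.pow 2).mul (((re hN).mul (re hP)).add ((im hN).mul (im hP))))
  refine HasDerivAt.congr_deriv (f := energyFlux lam U P) key ?_
  have hD' : -(1 - (ρ : ℂ) ^ 2) * ρ ^ 2 * D - 2 * (1 - (ρ : ℂ) ^ 2) * ρ * P ρ
      + 2 * lam * (ρ : ℂ) ^ 3 * P ρ + ((partnerPotential ρ : ℝ) : ℂ) * U ρ
      + ρ ^ 2 * (lam * (lam + 1)) * U ρ = 0 := by
    have hc : (ρ : ℂ) ≠ 0 := by exact_mod_cast hρ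
    have e := congrArg (fun z => (ρ : ℂ) ^ 2 * z) hD
    simp only [mul_zero] at e
    rw [← e]
    field_simp
  have r1 := congrArg Complex.re hD'
  have r2 := congrArg Complex.im hD'
  -- Expresses the derivative of the potential through the factor `k` of the target, so that
  -- potential and `k` can become free variables.
  have e : -16 * ρ / (1 + ρ ^ 2) ^ 2 = (-2 / ρ) * (8 * ρ ^ 2 / (1 + ρ ^ 2) ^ 2) := by
    field_simp; norm_num
  simp only [← Complex.ofReal_pow, ← Complex.ofReal_one, ← Complex.ofReal_sub,
    Complex.add_re, Complex.add_im, Complex.sub_re, Complex.sub_im,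
    Complex.mul_re, Complex.mul_im, Complex.neg_re, Complex.neg_im, Complex.ofReal_re,
    Complex.ofReal_im, Complex.zero_re, Complex.zero_im, Complex.re_ofNat,
    Complex.im_ofNat, Complex.normSq_apply, Pi.mul_apply, Pi.add_apply, Pi.pow_apply] at r1 r2 ⊢
  rw [e]
  generalize 8 * ρ ^ 2 / (1 + ρ ^ 2) ^ 2 = k
  generalize partnerPotential ρ = V at *
  field_simp
  push_cast
  -- The real part of the equation times twice the conjugate of λU + ρP.
  linear_combination 2 * (lam.re * (U ρ).re - lam.im * (U ρ).im + ρ * (P ρ).re) * r1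
    + 2 * (lam.re * (U ρ).im + lam.im * (U ρ).re + ρ * (P ρ).im) * r2

/-- An eigenfunction of the partner equation with `Re lam ≥ 1/2` whose energy flux vanishes at the
centre is zero. -/
theorem partner_eq_zero {lam : ℂ} (hlam : 1 / 2 ≤ lam.re) {U P D : ℝ → ℂ}
    (hU : ∀ ρ ∈ Ioo (0 : ℝ) 1, HasDerivAt U (P ρ) ρ)
    (hP : ∀ ρ ∈ Ioo (0 : ℝ) 1, HasDerivAt P (D ρ) ρ)
    (hUc : ContinuousOn U (Ioc 0 1)) (hPc : ContinuousOn P (Ioc 0 1))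
    (hU0 : Tendsto U (𝓝[>] 0) (𝓝 0)) (hP0 : Tendsto (fun ρ : ℝ => ρ * P ρ) (𝓝[>] 0) (𝓝 0))
    (hD : ∀ ρ ∈ Ioo (0 : ℝ) 1,
      -(1 - (ρ : ℂ) ^ 2) * D ρ - 2 * ((1 - (ρ : ℂ) ^ 2) / (ρ : ℂ)) * P ρ
      + 2 * lam * (ρ : ℂ) * P ρ + ((partnerPotential ρ : ℝ) : ℂ) / (ρ : ℂ) ^ 2 * U ρ
      + lam * (lam + 1) * U ρ = 0) :
    ∀ ρ ∈ Ioo (0 : ℝ) 1, U ρ = 0 := by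
  have hder : ∀ ρ ∈ Ioo (0 : ℝ) 1, _ := fun ρ hρ =>
    hasDerivAt_energyFlux hρ.1.ne' (hU ρ hρ) (hP ρ hρ) (hD ρ hρ)
  have hVc : Continuous partnerPotential :=
    continuous_iff_continuousAt.2 fun ρ => (hasDerivAt_partnerPotential ρ).continuousAt
  have hcont : ContinuousOn (energyFlux lam U P) (Ioc 0 1) := by
    unfold energyFlux
    have hn : Continuous Complex.normSq := Complex.continuous_normSq
    have hN : ContinuousOn (fun x : ℝ => lam * U x + x * P x) (Ioc 0 1) := by fun_prop
    have h1 := hn.comp_continuousOn hN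
    have h2 := hn.comp_continuousOn hPc
    have h3 := hn.comp_continuousOn hUc
    have h4 := Complex.continuous_re.comp_continuousOn hN
    have h5 := Complex.continuous_re.comp_continuousOn hPc
    have h6 := Complex.continuous_im.comp_continuousOn hN
    have h7 := Complex.continuous_im.comp_continuousOn hPc
    simp only [Function.comp_def] at h1 h2 h3 h4 h5 h6 h7
    fun_prop
  have hle : ∀ ρ ∈ Ioo (0 : ℝ) 1, (1 - 2 * lam.re) * (ρ ^ 2 *
      (Complex.normSq (lam * U ρ + ρ * P ρ) + Complex.normSq (P ρ))
        + partnerPotential ρ * Complex.normSq (U ρ)) / 2 ≤ 0 := by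
    intro ρ hρ
    have hV := (partnerPotential_pos hρ.1.le hρ.2.le).le
    have h1 := Complex.normSq_nonneg (lam * U ρ + ρ * P ρ)
    have h2 := Complex.normSq_nonneg (P ρ)
    have h3 := Complex.normSq_nonneg (U ρ)
    have h4 : 0 ≤ ρ ^ 2 * (Complex.normSq (lam * U ρ + ρ * P ρ) + Complex.normSq (P ρ))
        + partnerPotential ρ * Complex.normSq (U ρ) := by positivity
    have h5 := mul_nonneg (show 0 ≤ 2 * lam.re - 1 by linarith) h4
    linarith
  have hanti : AntitoneOn (energyFlux lam U P) (Ioc 0 1) := by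
    refine antitoneOn_of_deriv_nonpos (convex_Ioc 0 1) hcont ?_ ?_
    · rw [interior_Ioc]
      exact fun ρ hρ => (hder ρ hρ).differentiableAt.differentiableWithinAt
    · rw [interior_Ioc]
      intro ρ hρ
      rw [(hder ρ hρ).deriv]
      have h3 : 0 ≤ 8 * ρ ^ 2 / (1 + ρ ^ 2) ^ 2 * Complex.normSq (U ρ) :=
        mul_nonneg (by positivity) (Complex.normSq_nonneg _)
      linarith [hle ρ hρ]
  have hlim : Tendsto (energyFlux lam U P) (𝓝[>] 0) (𝓝 0) := by
    have hρ : Tendsto (fun ρ : ℝ => ρ) (𝓝[>] 0) (𝓝 0) := tendsto_id.mono_left inf_le_left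
    have hN : Tendsto (fun x : ℝ => lam * U x + x * P x) (𝓝[>] 0) (𝓝 0) := by
      simpa using (hU0.const_mul lam).add hP0
    have hV : Tendsto partnerPotential (𝓝[>] 0) (𝓝 (partnerPotential 0)) :=
      (hVc.tendsto 0).mono_left inf_le_left
    have nsq {f : ℝ → ℂ} (h : Tendsto f (𝓝[>] 0) (𝓝 0)) :
        Tendsto (fun x => Complex.normSq (f x)) (𝓝[>] 0) (𝓝 0) := by
      simpa [Function.comp_def] using (Complex.continuous_normSq.tendsto 0).comp h
    have re {f : ℝ → ℂ} (h : Tendsto f (𝓝[>] 0) (𝓝 0)) :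
        Tendsto (fun x => (f x).re) (𝓝[>] 0) (𝓝 0) := by
      simpa [Function.comp_def] using (Complex.continuous_re.tendsto 0).comp h
    have im {f : ℝ → ℂ} (h : Tendsto f (𝓝[>] 0) (𝓝 0)) :
        Tendsto (fun x => (f x).im) (𝓝[>] 0) (𝓝 0) := by
      simpa [Function.comp_def] using (Complex.continuous_im.tendsto 0).comp h
    -- Only ρP, not P, is known to tend to 0, so powers of ρ are regrouped to make P occur as ρP.
    have h := ((((hρ.pow 3).mul (nsq hN)).add (hρ.mul (nsq hP0))).add
      (hρ.mul (hV.mul (nsq hU0)))).div_const 2 |>.sub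
      (hρ.mul (((re hN).mul (re hP0)).add ((im hN).mul (im hP0))))
    simp only [mul_zero, add_zero, zero_div, sub_zero] at h
    refine h.congr fun ρ => ?_
    simp only [energyFlux, Complex.normSq_apply, Complex.mul_re, Complex.mul_im,
      Complex.ofReal_re, Complex.ofReal_im]
    ring
  -- With N = λU + P, the flux at 1 is |N - P|²/2 plus half the potential term.
  have hone : 0 ≤ energyFlux lam U P 1 := by
    have h3 := mul_nonneg (partnerPotential_pos zero_le_one le_rfl).le
      (Complex.normSq_nonneg (U 1))
    simp only [energyFlux, Complex.normSq_apply] at h3 ⊢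
    nlinarith [sq_nonneg ((lam * U 1 + (1 : ℝ) * P 1).re - (P 1).re),
      sq_nonneg ((lam * U 1 + (1 : ℝ) * P 1).im - (P 1).im)]
  have hzero : ∀ ρ ∈ Ioo (0 : ℝ) 1, energyFlux lam U P ρ = 0 := by
    intro ρ hρ
    refine le_antisymm (ge_of_tendsto hlim ?_) (hone.trans
      (hanti ⟨hρ.1, hρ.2.le⟩ ⟨one_pos, le_rfl⟩ hρ.2.le))
    filter_upwards [Ioo_mem_nhdsGT hρ.1] with x hx
    exact hanti ⟨hx.1, (hx.2.trans hρ.2).le⟩ ⟨hρ.1, hρ.2.le⟩ hx.2.le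
  intro ρ hρ
  have h0 : HasDerivAt (energyFlux lam U P) 0 ρ :=
    (hasDerivAt_const ρ (0 : ℝ)).congr_of_eventuallyEq
      (eventually_of_mem (isOpen_Ioo.mem_nhds hρ) hzero)
  -- Both terms of the derivative are nonpositive. The one from the decreasing potential forces U =
  -- 0 even at Re λ = 1/2, where the other vanishes.
  have heq := (hder ρ hρ).unique h0
  have hk : 0 < 8 * ρ ^ 2 / (1 + ρ ^ 2) ^ 2 := by have := hρ.1; positivity
  have h3 := Complex.normSq_nonneg (U ρ)
  have h5 := mul_nonneg hk.le h3
  have : 8 * ρ ^ 2 / (1 + ρ ^ 2) ^ 2 * Complex.normSq (U ρ) = 0 := by linarith [hle ρ hρ]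
  exact Complex.normSq_eq_zero.1 ((mul_eq_zero.1 this).resolve_left hk.ne')

/-! ### The Darboux transform and its algebra -/

/-- The Darboux transform of `u`, with `v` in the role of `u'`. It intertwines the eigenvalue
equation with the partner equation. -/
noncomputable def darboux (lam : ℂ) (u v : ℝ → ℂ) (ρ : ℝ) : ℂ :=
  ((1 - ρ ^ 2 : ℝ) : ℂ) * v ρ - (lam - 1) * ρ * u ρ
    - (((1 - ρ ^ 2) ^ 2 / (ρ + ρ ^ 3) : ℝ) : ℂ) * u ρ

/-- The derivative of `darboux lam u u'` for a solution `u` of the eigenvalue equation, with the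
second derivative of `u` eliminated. -/
noncomputable def darbouxDeriv (lam : ℂ) (u v : ℝ → ℂ) (ρ : ℝ) : ℂ :=
  ((lam - 1) * ρ - (((3 - 2 * ρ ^ 2 - ρ ^ 4) / (ρ + ρ ^ 3) : ℝ) : ℂ)) * v ρ
    + ((((3 - 7 * ρ ^ 2 - 3 * ρ ^ 4 - ρ ^ 6) / (ρ + ρ ^ 3) ^ 2 : ℝ) : ℂ) + (lam ^ 2 + 1)) * u ρ

/-- The derivative of `darbouxDeriv lam u u'`, with `w` in the role of `u''`. -/
noncomputable def darbouxDeriv₂ (lam : ℂ) (u v w : ℝ → ℂ) (ρ : ℝ) : ℂ :=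
  ((lam - 1) - (((-(4 * ρ + 4 * ρ ^ 3) * (ρ + ρ ^ 3) - (3 - 2 * ρ ^ 2 - ρ ^ 4) * (1 + 3 * ρ ^ 2))
      / (ρ + ρ ^ 3) ^ 2 : ℝ) : ℂ)) * v ρ
    + ((lam - 1) * ρ - (((3 - 2 * ρ ^ 2 - ρ ^ 4) / (ρ + ρ ^ 3) : ℝ) : ℂ)) * w ρ
    + ((((-(14 * ρ + 12 * ρ ^ 3 + 6 * ρ ^ 5) * (ρ + ρ ^ 3)
        - 2 * (3 - 7 * ρ ^ 2 - 3 * ρ ^ 4 - ρ ^ 6) * (1 + 3 * ρ ^ 2))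
        / (ρ + ρ ^ 3) ^ 3 : ℝ) : ℂ) * u ρ
      + ((((3 - 7 * ρ ^ 2 - 3 * ρ ^ 4 - ρ ^ 6) / (ρ + ρ ^ 3) ^ 2 : ℝ) : ℂ) + (lam ^ 2 + 1)) * v ρ)

/-- The eigenvalue equation as a relation between the values of `u`, `u'`, `u''`. -/
def EigenRelation (lam : ℂ) (u v w : ℝ → ℂ) (ρ : ℝ) : Prop :=
  -(1 - (ρ : ℂ) ^ 2) * w ρ - 2 * ((1 - (ρ : ℂ) ^ 2) / (ρ : ℂ)) * v ρ + 2 * lam * (ρ : ℂ) * v ρ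
    + ((potentialV ρ : ℝ) : ℂ) / (ρ : ℂ) ^ 2 * u ρ + lam * (lam + 1) * u ρ = 0

section Pointwise

variable {lam : ℂ} {u v w : ℝ → ℂ} {ρ : ℝ}

theorem ofReal_one_add_sq_ne_zero (ρ : ℝ) : (1 + (ρ : ℂ) ^ 2) ≠ 0 := by
  have h : (1 + ρ ^ 2) ≠ 0 := by positivity
  exact_mod_cast h

theorem add_cube_ne_zero (hρ : ρ ≠ 0) : ρ + ρ ^ 3 ≠ 0 := by
  have : ρ + ρ ^ 3 = ρ * (1 + ρ ^ 2) := by ring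
  rw [this]
  positivity

theorem ofReal_add_cube (ρ : ℝ) : (ρ : ℂ) + (ρ : ℂ) ^ 3 = ρ * (1 + (ρ : ℂ) ^ 2) := by ring

/-- The eigenvalue equation with denominators cleared. -/
theorem EigenRelation.cleared (hρ : ρ ≠ 0) (h : EigenRelation lam u v w ρ) :
    (1 + (ρ : ℂ) ^ 2) ^ 2 * (-(1 - (ρ : ℂ) ^ 2) * ρ ^ 2 * w ρ - 2 * (1 - (ρ : ℂ) ^ 2) * ρ * v ρ
      + 2 * lam * (ρ : ℂ) ^ 3 * v ρ + ρ ^ 2 * lam * (lam + 1) * u ρ)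
      + 2 * (1 - 6 * (ρ : ℂ) ^ 2 + (ρ : ℂ) ^ 4) * u ρ = 0 := by
  have hc : (ρ : ℂ) ≠ 0 := by exact_mod_cast hρ
  have h1 := ofReal_one_add_sq_ne_zero ρ
  have e := congrArg (fun z => (1 + (ρ : ℂ) ^ 2) ^ 2 * (ρ : ℂ) ^ 2 * z) h
  simp only [mul_zero, potentialV_eq] at e
  rw [← e]
  push_cast
  field_simp
  ring

theorem hasDerivAt_darboux (hρ : ρ ≠ 0) (hu : HasDerivAt u (v ρ) ρ) (hv : HasDerivAt v (w ρ) ρ)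
    (h : EigenRelation lam u v w ρ) :
    HasDerivAt (darboux lam u v) (darbouxDeriv lam u v ρ) ρ := by
  have hc : (ρ : ℂ) ≠ 0 := by exact_mod_cast hρ
  have h1 := ofReal_one_add_sq_ne_zero ρ
  have hid : HasDerivAt (fun x : ℝ => x) 1 ρ := hasDerivAt_id ρ
  have hs := (hasDerivAt_pow 2 ρ).const_sub 1
  have hk := (hs.pow 2).div (hid.add (hasDerivAt_pow 3 ρ)) (add_cube_ne_zero hρ)
  have key := ((hs.ofReal_comp.mul hv).sub ((hid.ofReal_comp.const_mul (lam - 1)).mul hu)).sub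
    (hk.ofReal_comp.mul hu)
  refine HasDerivAt.congr_deriv (f := darboux lam u v) key ?_
  have e := h.cleared hρ
  simp only [darbouxDeriv, Pi.add_apply, Pi.pow_apply, Pi.div_apply]
  push_cast
  simp only [ofReal_add_cube]
  field_simp
  linear_combination (-1) * e

theorem hasDerivAt_darbouxDeriv (hρ : ρ ≠ 0) (hu : HasDerivAt u (v ρ) ρ)
    (hv : HasDerivAt v (w ρ) ρ) :
    HasDerivAt (darbouxDeriv lam u v) (darbouxDeriv₂ lam u v w ρ) ρ := by
  have hr := add_cube_ne_zero hρ
  have hid : HasDerivAt (fun x : ℝ => x) 1 ρ := hasDerivAt_id ρ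
  have hd := hid.add (hasDerivAt_pow 3 ρ)
  have ha := ((((hasDerivAt_pow 2 ρ).const_mul 2).const_sub 3).sub (hasDerivAt_pow 4 ρ)).div hd hr
  have hb := (((((hasDerivAt_pow 2 ρ).const_mul 7).const_sub 3).sub
    ((hasDerivAt_pow 4 ρ).const_mul 3)).sub (hasDerivAt_pow 6 ρ)).div (hd.pow 2) (pow_ne_zero 2 hr)
  have ha' := ha.congr_deriv (g' := (-(4 * ρ + 4 * ρ ^ 3) * (ρ + ρ ^ 3)
    - (3 - 2 * ρ ^ 2 - ρ ^ 4) * (1 + 3 * ρ ^ 2)) / (ρ + ρ ^ 3) ^ 2) (by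
      simp only [Pi.add_apply, Pi.sub_apply]
      push_cast
      ring)
  have hb' := hb.congr_deriv (g' := (-(14 * ρ + 12 * ρ ^ 3 + 6 * ρ ^ 5) * (ρ + ρ ^ 3)
        - 2 * (3 - 7 * ρ ^ 2 - 3 * ρ ^ 4 - ρ ^ 6) * (1 + 3 * ρ ^ 2)) / (ρ + ρ ^ 3) ^ 3) (by
      simp only [Pi.add_apply, Pi.sub_apply, Pi.pow_apply]
      rw [div_eq_div_iff (by positivity) (pow_ne_zero 3 hr)]
      push_cast
      ring)
  have key := (((hid.ofReal_comp.const_mul (lam - 1)).sub ha'.ofReal_comp).mul hv).add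
    ((hb'.ofReal_comp.add_const (lam ^ 2 + 1)).mul hu)
  refine HasDerivAt.congr_deriv (f := darbouxDeriv lam u v) key ?_
  simp [darbouxDeriv₂]

/-- The Darboux transform of a solution solves the partner equation. -/
theorem darboux_partner_equation (hρ : ρ ≠ 0) (h : EigenRelation lam u v w ρ) :
    -(1 - (ρ : ℂ) ^ 2) * darbouxDeriv₂ lam u v w ρ
      - 2 * ((1 - (ρ : ℂ) ^ 2) / (ρ : ℂ)) * darbouxDeriv lam u v ρ
      + 2 * lam * (ρ : ℂ) * darbouxDeriv lam u v ρ
      + ((partnerPotential ρ : ℝ) : ℂ) / (ρ : ℂ) ^ 2 * darboux lam u v ρ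
      + lam * (lam + 1) * darboux lam u v ρ = 0 := by
  have hc : (ρ : ℂ) ≠ 0 := by exact_mod_cast hρ
  have h1 := ofReal_one_add_sq_ne_zero ρ
  have e := h.cleared hρ
  simp only [darbouxDeriv₂, darbouxDeriv, darboux, partnerPotential]
  push_cast
  simp only [ofReal_add_cube]
  field_simp
  -- The multiplier is the coefficient of `w` in `darbouxDeriv₂`, times ρ + ρ³.
  linear_combination ((lam - 1) * ρ ^ 2 * (1 + (ρ : ℂ) ^ 2)
    - (3 - 2 * (ρ : ℂ) ^ 2 - (ρ : ℂ) ^ 4)) * e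

theorem lam_sub_one_sq_mul_eq_zero (hρ : ρ ≠ 0) (hU : darboux lam u v ρ = 0)
    (hP : darbouxDeriv lam u v ρ = 0) : (lam - 1) ^ 2 * u ρ = 0 := by
  have hc : (ρ : ℂ) ≠ 0 := by exact_mod_cast hρ
  have h1 := ofReal_one_add_sq_ne_zero ρ
  have e : (lam - 1) ^ 2 * u ρ = (1 - (ρ : ℂ) ^ 2) * darbouxDeriv lam u v ρ
      - ((lam - 1) * ρ - (((3 - 2 * ρ ^ 2 - ρ ^ 4) / (ρ + ρ ^ 3) : ℝ) : ℂ))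
        * darboux lam u v ρ := by
    simp only [darbouxDeriv, darboux]
    push_cast
    simp only [ofReal_add_cube]
    field_simp
    ring
  rw [e, hU, hP, mul_zero, mul_zero, sub_zero]

end Pointwise

/-! ### Boundary behaviour and the kernel -/

section Interval

variable {lam : ℂ} {u v w : ℝ → ℂ}

theorem continuousOn_darboux (hu : ContinuousOn u (Icc 0 1)) (hv : ContinuousOn v (Icc 0 1)) :
    ContinuousOn (darboux lam u v) (Ioc 0 1) := by
  have hu' := hu.mono Ioc_subset_Icc_self
  have hv' := hv.mono Ioc_subset_Icc_self
  have hk : ContinuousOn (fun ρ : ℝ => (1 - ρ ^ 2) ^ 2 / (ρ + ρ ^ 3)) (Ioc 0 1) :=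
    ContinuousOn.div (by fun_prop) (by fun_prop) fun ρ hρ => add_cube_ne_zero hρ.1.ne'
  unfold darboux
  fun_prop

theorem continuousOn_darbouxDeriv (hu : ContinuousOn u (Icc 0 1))
    (hv : ContinuousOn v (Icc 0 1)) : ContinuousOn (darbouxDeriv lam u v) (Ioc 0 1) := by
  have hu' := hu.mono Ioc_subset_Icc_self
  have hv' := hv.mono Ioc_subset_Icc_self
  have ha : ContinuousOn (fun ρ : ℝ => (3 - 2 * ρ ^ 2 - ρ ^ 4) / (ρ + ρ ^ 3)) (Ioc 0 1) :=
    (by fun_prop : Continuous fun ρ : ℝ => 3 - 2 * ρ ^ 2 - ρ ^ 4).continuousOn.div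
      (by fun_prop) fun ρ hρ => add_cube_ne_zero hρ.1.ne'
  have hb : ContinuousOn (fun ρ : ℝ => (3 - 7 * ρ ^ 2 - 3 * ρ ^ 4 - ρ ^ 6) / (ρ + ρ ^ 3) ^ 2)
      (Ioc 0 1) :=
    (by fun_prop : Continuous fun ρ : ℝ => 3 - 7 * ρ ^ 2 - 3 * ρ ^ 4 - ρ ^ 6).continuousOn.div
      (by fun_prop) fun ρ hρ => pow_ne_zero 2 (add_cube_ne_zero hρ.1.ne')
  have hid : ContinuousOn (fun ρ : ℝ => (lam - 1) * (ρ : ℂ)) (Ioc 0 1) := by fun_prop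
  exact ((hid.sub (Complex.continuous_ofReal.comp_continuousOn ha)).mul hv').add
    (((Complex.continuous_ofReal.comp_continuousOn hb).add continuousOn_const).mul hu')

theorem tendsto_div_zero (hu : HasDerivWithinAt u (v 0) (Icc 0 1) 0) (h0 : u 0 = 0) :
    Tendsto (fun ρ : ℝ => u ρ / ρ) (𝓝[>] 0) (𝓝 (v 0)) := by
  have hmem : Icc (0 : ℝ) 1 ∈ 𝓝[>] (0 : ℝ) :=
    mem_of_superset (Ioo_mem_nhdsGT one_pos) Ioo_subset_Icc_self
  have h : HasDerivWithinAt u (v 0) (Ioi 0) 0 := HasDerivWithinAt.mono_of_mem_nhdsWithin hu hmem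
  rw [hasDerivWithinAt_iff_tendsto_slope' (by simp)] at h
  refine h.congr fun ρ => ?_
  rw [slope_def_module, h0, sub_zero, sub_zero, Complex.real_smul, Complex.ofReal_inv,
    div_eq_inv_mul]

/-- `f` agrees near `0⁺` with a combination `A v + B (u/ρ)` with continuous `A`, `B` that cancel
at `0`. -/
theorem tendsto_zero_of_cancel {f A B : ℝ → ℂ} (hA : Continuous A) (hB : Continuous B)
    (hAB : A 0 + B 0 = 0) (hv : ContinuousOn v (Icc 0 1))
    (hu : HasDerivWithinAt u (v 0) (Icc 0 1) 0) (h0 : u 0 = 0)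
    (hf : ∀ ρ : ℝ, 0 < ρ → f ρ = A ρ * v ρ + B ρ * (u ρ / ρ)) :
    Tendsto f (𝓝[>] 0) (𝓝 0) := by
  have hv0 : Tendsto v (𝓝[>] 0) (𝓝 (v 0)) :=
    (hv 0 ⟨le_rfl, zero_le_one⟩).mono_left (nhdsWithin_le_iff.2
      (mem_of_superset (Ioo_mem_nhdsGT one_pos) Ioo_subset_Icc_self))
  have h := (((hA.tendsto 0).mono_left inf_le_left).mul hv0).add
    (((hB.tendsto 0).mono_left inf_le_left).mul (tendsto_div_zero hu h0))
  rw [← add_mul, hAB, zero_mul] at h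
  refine h.congr' ?_
  filter_upwards [self_mem_nhdsWithin] with ρ hρ
  exact (hf ρ hρ).symm

/-- Both u' and u/ρ tend to u'(0), and their coefficients tend to 1 and -1. -/
theorem tendsto_darboux_zero (hv : ContinuousOn v (Icc 0 1))
    (hu : HasDerivWithinAt u (v 0) (Icc 0 1) 0) (h0 : u 0 = 0) :
    Tendsto (darboux lam u v) (𝓝[>] 0) (𝓝 0) := by
  refine tendsto_zero_of_cancel (A := fun ρ : ℝ => 1 - (ρ : ℂ) ^ 2)
    (B := fun ρ : ℝ => -(lam - 1) * ρ ^ 2 - (1 - (ρ : ℂ) ^ 2) ^ 2 / (1 + (ρ : ℂ) ^ 2))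
    (by fun_prop) ?_ (by simp) hv hu h0 fun ρ hρ => ?_
  · exact (by fun_prop : Continuous _).sub
      ((by fun_prop : Continuous _).div (by fun_prop) ofReal_one_add_sq_ne_zero)
  · have hc : (ρ : ℂ) ≠ 0 := by exact_mod_cast hρ.ne'
    have h1 := ofReal_one_add_sq_ne_zero ρ
    simp only [darboux]
    push_cast
    simp only [ofReal_add_cube]
    field_simp
    ring

/-- The same cancellation, with limiting coefficients -3 and 3. -/
theorem tendsto_mul_darbouxDeriv_zero (hv : ContinuousOn v (Icc 0 1))
    (hu : HasDerivWithinAt u (v 0) (Icc 0 1) 0) (h0 : u 0 = 0) :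
    Tendsto (fun ρ : ℝ => ρ * darbouxDeriv lam u v ρ) (𝓝[>] 0) (𝓝 0) := by
  refine tendsto_zero_of_cancel
    (A := fun ρ : ℝ => (lam - 1) * ρ ^ 2
      - (3 - 2 * (ρ : ℂ) ^ 2 - (ρ : ℂ) ^ 4) / (1 + (ρ : ℂ) ^ 2))
    (B := fun ρ : ℝ => (lam ^ 2 + 1) * ρ ^ 2
      + (3 - 7 * (ρ : ℂ) ^ 2 - 3 * (ρ : ℂ) ^ 4 - (ρ : ℂ) ^ 6) / (1 + (ρ : ℂ) ^ 2) ^ 2)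
    ?_ ?_ (by simp) hv hu h0 fun ρ hρ => ?_
  · exact (by fun_prop : Continuous _).sub
      ((by fun_prop : Continuous _).div (by fun_prop) ofReal_one_add_sq_ne_zero)
  · exact (by fun_prop : Continuous _).add
      ((by fun_prop : Continuous _).div (by fun_prop)
        fun ρ => pow_ne_zero 2 (ofReal_one_add_sq_ne_zero ρ))
  · have hc : (ρ : ℂ) ≠ 0 := by exact_mod_cast hρ.ne'
    have h1 := ofReal_one_add_sq_ne_zero ρ
    simp only [darbouxDeriv]
    push_cast
    simp only [ofReal_add_cube]
    field_simp
    ring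

theorem eqOn_Icc_of_eqOn_Ioo {f g : ℝ → ℂ} (hf : ContinuousOn f (Icc 0 1))
    (hg : ContinuousOn g (Icc 0 1)) (h : EqOn f g (Ioo 0 1)) : EqOn f g (Icc 0 1) :=
  h.of_subset_closure hf hg Ioo_subset_Icc_self (closure_Ioo zero_ne_one).ge

/-- The cleared equation extends continuously to ρ = 0, where only 2u(0) survives. -/
theorem eigenSolution_apply_zero (hu : ContinuousOn u (Icc 0 1)) (hv : ContinuousOn v (Icc 0 1))
    (hw : ContinuousOn w (Icc 0 1)) (h : ∀ ρ ∈ Ioo (0 : ℝ) 1, EigenRelation lam u v w ρ) :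
    u 0 = 0 := by
  have := eqOn_Icc_of_eqOn_Ioo (g := fun _ => 0) (by fun_prop) continuousOn_const
    (fun ρ hρ => (h ρ hρ).cleared hρ.1.ne') (left_mem_Icc.2 zero_le_one)
  simpa using this

theorem darboux_eq_zero (hlam : 1 / 2 ≤ lam.re)
    (hu : ∀ ρ ∈ Icc (0 : ℝ) 1, HasDerivWithinAt u (v ρ) (Icc 0 1) ρ)
    (hv : ∀ ρ ∈ Icc (0 : ℝ) 1, HasDerivWithinAt v (w ρ) (Icc 0 1) ρ)
    (hw : ContinuousOn w (Icc 0 1))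
    (h : ∀ ρ ∈ Ioo (0 : ℝ) 1, EigenRelation lam u v w ρ) :
    ∀ ρ ∈ Ioo (0 : ℝ) 1, darboux lam u v ρ = 0 ∧ darbouxDeriv lam u v ρ = 0 := by
  have hnhds : ∀ ρ ∈ Ioo (0 : ℝ) 1, Icc (0 : ℝ) 1 ∈ 𝓝 ρ := fun ρ hρ => Icc_mem_nhds hρ.1 hρ.2
  have hu' : ∀ ρ ∈ Ioo (0 : ℝ) 1, HasDerivAt u (v ρ) ρ := fun ρ hρ =>
    (hu ρ (Ioo_subset_Icc_self hρ)).hasDerivAt (hnhds ρ hρ)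
  have hv' : ∀ ρ ∈ Ioo (0 : ℝ) 1, HasDerivAt v (w ρ) ρ := fun ρ hρ =>
    (hv ρ (Ioo_subset_Icc_self hρ)).hasDerivAt (hnhds ρ hρ)
  have huc : ContinuousOn u (Icc 0 1) := fun ρ hρ => (hu ρ hρ).continuousWithinAt
  have hvc : ContinuousOn v (Icc 0 1) := fun ρ hρ => (hv ρ hρ).continuousWithinAt
  have h0 := eigenSolution_apply_zero huc hvc hw h
  have hu0 := hu 0 (left_mem_Icc.2 zero_le_one)
  have hd : ∀ ρ ∈ Ioo (0 : ℝ) 1, HasDerivAt (darboux lam u v) (darbouxDeriv lam u v ρ) ρ :=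
    fun ρ hρ => hasDerivAt_darboux hρ.1.ne' (hu' ρ hρ) (hv' ρ hρ) (h ρ hρ)
  have hU : ∀ ρ ∈ Ioo (0 : ℝ) 1, darboux lam u v ρ = 0 :=
    partner_eq_zero hlam hd
      (fun ρ hρ => hasDerivAt_darbouxDeriv hρ.1.ne' (hu' ρ hρ) (hv' ρ hρ))
      (continuousOn_darboux huc hvc) (continuousOn_darbouxDeriv huc hvc)
      (tendsto_darboux_zero hvc hu0 h0) (tendsto_mul_darbouxDeriv_zero hvc hu0 h0)
      (fun ρ hρ => darboux_partner_equation hρ.1.ne' (h ρ hρ))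
  refine fun ρ hρ => ⟨hU ρ hρ, (hd ρ hρ).unique ?_⟩
  exact (hasDerivAt_const ρ (0 : ℂ)).congr_of_eventuallyEq
    (eventually_of_mem (isOpen_Ioo.mem_nhds hρ) hU)

/-- The kernel of the Darboux transform at `lam = 1` is spanned by `ρ/(1+ρ²)`. -/
theorem eq_const_mul_of_darboux_eq_zero (huc : ContinuousOn u (Icc 0 1))
    (hu : ∀ ρ ∈ Ioo (0 : ℝ) 1, HasDerivAt u (v ρ) ρ)
    (hU : ∀ ρ ∈ Ioo (0 : ℝ) 1, darboux 1 u v ρ = 0) :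
    ∃ c : ℂ, ∀ ρ ∈ Icc (0 : ℝ) 1, u ρ = c * (ρ : ℂ) / (1 + (ρ : ℂ) ^ 2) := by
  -- The quotient u/g with g = ρ/(1+ρ²) is constant, since `darboux 1` is (1-ρ²)(u' - (g'/g)u).
  have hder : ∀ ρ ∈ Ioo (0 : ℝ) 1,
      HasDerivAt (fun x : ℝ => u x * (((1 + x ^ 2) / x : ℝ) : ℂ)) 0 ρ := by
    intro ρ hρ
    have hid : HasDerivAt (fun x : ℝ => x) 1 ρ := hasDerivAt_id ρ
    have hq := ((hasDerivAt_pow 2 ρ).const_add 1).div hid hρ.1.ne'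
    refine ((hu ρ hρ).mul hq.ofReal_comp).congr_deriv ?_
    have hc : (ρ : ℂ) ≠ 0 := by exact_mod_cast hρ.1.ne'
    have h1 := ofReal_one_add_sq_ne_zero ρ
    have h2 : (1 - (ρ : ℂ) ^ 2) ≠ 0 := by
      have : (1 - ρ ^ 2) ≠ 0 := by nlinarith [hρ.1, hρ.2]
      exact_mod_cast this
    have e := hU ρ hρ
    simp only [darboux] at e
    push_cast at e ⊢
    simp only [ofReal_add_cube] at e
    field_simp at e ⊢
    simp only [Pi.div_apply]
    push_cast
    field_simp
    refine mul_left_cancel₀ h2 ?_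
    linear_combination e
  obtain ⟨c, hc⟩ := isOpen_Ioo.exists_is_const_of_deriv_eq_zero (isPreconnected_Ioo)
    (fun ρ hρ => (hder ρ hρ).differentiableAt.differentiableWithinAt)
    (fun ρ hρ => (hder ρ hρ).deriv)
  refine ⟨c, eqOn_Icc_of_eqOn_Ioo huc ?_ fun ρ hρ => ?_⟩
  · exact (Continuous.div (by fun_prop) (by fun_prop) ofReal_one_add_sq_ne_zero).continuousOn
  · have hρ0 : (ρ : ℂ) ≠ 0 := by exact_mod_cast hρ.1.ne'
    have h1 := ofReal_one_add_sq_ne_zero ρ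
    have e := hc ρ hρ
    push_cast at e
    rw [← e]
    field_simp

end Interval

/-! ### Conclusion -/

theorem proposition3p2 (lam : ℂ) (u : ℝ → ℂ)
    (hu : IsSmoothEigenSolution lam u)
    (hnontrivial : ∃ ρ ∈ Set.Icc (0 : ℝ) 1, u ρ ≠ 0)
    (hlam : 1 / 2 ≤ lam.re) :
    lam = 1 ∧ ∃ c : ℂ, c ≠ 0 ∧
      ∀ ρ ∈ Set.Icc (0 : ℝ) 1, u ρ = c * (ρ : ℂ) / (1 + (ρ : ℂ) ^ 2) := by
  have hs : UniqueDiffOn ℝ (Icc (0 : ℝ) 1) := uniqueDiffOn_Icc one_pos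
  -- One-sided derivatives stay continuous up to the endpoints, while `deriv` there depends on u
  -- outside [0,1].
  set v := derivWithin u (Icc 0 1)
  set w := derivWithin v (Icc 0 1)
  have hvs : ContDiffOn ℝ ∞ v (Icc 0 1) := hu.smooth.derivWithin hs (by simp)
  have hws : ContDiffOn ℝ ∞ w (Icc 0 1) := hvs.derivWithin hs (by simp)
  have hud : ∀ ρ ∈ Icc (0 : ℝ) 1, HasDerivWithinAt u (v ρ) (Icc 0 1) ρ := fun ρ hρ =>
    (hu.smooth.differentiableOn (by simp) ρ hρ).hasDerivWithinAt
  have hvd : ∀ ρ ∈ Icc (0 : ℝ) 1, HasDerivWithinAt v (w ρ) (Icc 0 1) ρ := fun ρ hρ =>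
    (hvs.differentiableOn (by simp) ρ hρ).hasDerivWithinAt
  have hu' : ∀ ρ ∈ Ioo (0 : ℝ) 1, HasDerivAt u (v ρ) ρ := fun ρ hρ =>
    (hud ρ (Ioo_subset_Icc_self hρ)).hasDerivAt (Icc_mem_nhds hρ.1 hρ.2)
  have hv' : ∀ ρ ∈ Ioo (0 : ℝ) 1, HasDerivAt v (w ρ) ρ := fun ρ hρ =>
    (hvd ρ (Ioo_subset_Icc_self hρ)).hasDerivAt (Icc_mem_nhds hρ.1 hρ.2)
  have hode : ∀ ρ ∈ Ioo (0 : ℝ) 1, EigenRelation lam u v w ρ := by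
    intro ρ hρ
    have e : deriv u =ᶠ[𝓝 ρ] v :=
      eventually_of_mem (isOpen_Ioo.mem_nhds hρ) fun x hx => (hu' x hx).deriv
    have h := hu.ode ρ hρ
    rw [SatisfiesEigenvalueODEAt, e.deriv_eq, (hv' ρ hρ).deriv, (hu' ρ hρ).deriv] at h
    exact h
  have huc := hu.smooth.continuousOn
  have hzero := darboux_eq_zero hlam hud hvd hws.continuousOn hode
  obtain ⟨ρ₀, hρ₀, hne⟩ := hnontrivial
  have hlam1 : lam = 1 := by
    by_contra hl
    refine hne (eqOn_Icc_of_eqOn_Ioo (g := fun _ => 0) huc continuousOn_const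
      (fun ρ hρ => ?_) hρ₀)
    exact (mul_eq_zero.1 (lam_sub_one_sq_mul_eq_zero hρ.1.ne' (hzero ρ hρ).1
      (hzero ρ hρ).2)).resolve_left (pow_ne_zero 2 (sub_ne_zero.2 hl))
  subst hlam1
  obtain ⟨c, hc⟩ := eq_const_mul_of_darboux_eq_zero huc hu' fun ρ hρ => (hzero ρ hρ).1
  refine ⟨rfl, c, ?_, hc⟩
  rintro rfl
  exact hne (by rw [hc ρ₀ hρ₀]; simp)
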